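/- Fix $K\ge 1$ goods $\mathcal K=\{1,\dots,K\}$. A valuation is a function $v:2^{\mathcal K}\to\mathbb R$ with $v(\emptyset)=0$. For a price vector $p\in\mathbb R_{\ge 0}^K$ let $D(p)$ be the set of bundles $A\subseteq\mathcal K$ that maximize $v(A)-\sum_{k\in A}p_k$. The valuation $v$ is a substitute valuation if for all price vectors $p\le q$ (coordinatewise) and every $A\in D(p)$ there is $A'\in D(q)$ with $\{k\in A: p_k=q_k\}\subseteq A'$. Let $\mathcal S_K\subseteq\mathbb R^{2^{\mathcal K}}$ be the set of all substitute valuations that are nondecreasing with respect to inclusion. A polyhedron is a nonempty intersection of finitely many closed half-spaces, and its dimension is the dimension of the smallest affine subspace containing it. Then: (1) there is a polyhedron of dimension $2727$ contained in $\mathcal S_{16}$; (2) there is a polyhedron of dimension $424607$ contained in $\mathcal S_{24}$; (3) for every $K\ge 2$ there is a polyhedron contained in $\mathcal S_K$ of dimension at least $$2K-1+\frac{2^{K-1}-2}{K}.$$ -/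

import Mathlib

/-- A bundle is a finite set of the `K` goods; a set function assigns a real number to each. -/
abbrev BundleFun (K : ℕ) : Type := Finset (Fin K) → ℝ

/-- The demand correspondence at the price vector `p`: the bundles that maximize
the payoff `v A - ∑ k ∈ A, p k`. -/
def demand {K : ℕ} (v : BundleFun K) (p : Fin K → ℝ) : Set (Finset (Fin K)) :=
  {A | ∀ B : Finset (Fin K), v B - ∑ k ∈ B, p k ≤ v A - ∑ k ∈ A, p k}

/-- The substitute property: if the (nonnegative) prices increase from `p` to `q` and `A` is
demanded at `p`, then some bundle demanded at `q` contains all goods of `A` whose price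
did not change. -/
def HasSubstituteProperty {K : ℕ} (v : BundleFun K) : Prop :=
  ∀ p q : Fin K → ℝ, (∀ k, 0 ≤ p k) → (∀ k, p k ≤ q k) →
    ∀ A ∈ demand v p, ∃ A' ∈ demand v q, ∀ k ∈ A, p k = q k → k ∈ A'

/-- The set `S_K` of nondecreasing substitute valuations on `K` goods, normalized to be zero at
the empty bundle, as a subset of `ℝ^(2^K)`. -/
def substituteValuations (K : ℕ) : Set (BundleFun K) :=
  {v | v ∅ = 0 ∧ (∀ A B : Finset (Fin K), A ⊆ B → v A ≤ v B) ∧ HasSubstituteProperty v}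

/-- A closed half-space of a real vector space. -/
def IsHalfSpace {E : Type*} [AddCommGroup E] [Module ℝ E] (H : Set E) : Prop :=
  ∃ (a : E →ₗ[ℝ] ℝ) (b : ℝ), a ≠ 0 ∧ H = {x | a x ≤ b}

/-- A polyhedron: a nonempty intersection of finitely many half-spaces. -/
def IsPolyhedron {E : Type*} [AddCommGroup E] [Module ℝ E] (P : Set E) : Prop :=
  P.Nonempty ∧ ∃ F : Set (Set E), F.Finite ∧ (∀ H ∈ F, IsHalfSpace H) ∧ P = ⋂₀ F

/-- The dimension of (nonempty) `P`: the dimension of the smallest affine subspace containing it. -/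
noncomputable def polyhedronDim {E : Type*} [AddCommGroup E] [Module ℝ E] (P : Set E) : ℕ :=
  Module.finrank ℝ (affineSpan ℝ P).direction

/-! Take valuations `v A = ∑ k ∈ A, a k + g |A| - w A` with `g` strongly concave and `w` a small
penalty supported on a single-asymmetric-error code `C`. Codewords are so sparse that every exchange
required by the `M♮` property is trivial, can be chosen to create no penalty, or gains enough
concavity to pay for it. Hence `v` has the exchange property and so is a substitute valuation
(`IsAsymmetricCode.hasExchangeProperty`, `HasExchangeProperty.hasSubstituteProperty`).

The conditions on `(a, g, w)` are linear and strictly feasible, and the parametrization is linear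
and injective, so its image is a polyhedron of dimension `K + (K - 1) + |C|`. Large codes come from
pigeonhole on the residue of `∑ i ∈ A, (i + 1)` modulo `K + 1`. -/

/-- A code correcting a single asymmetric error: distinct codewords `X`, `Y` have
`|X \ Y| ≥ 2` or `|Y \ X| ≥ 2`. -/
def IsAsymmetricCode {α : Type*} [DecidableEq α] (C : Finset (Finset α)) : Prop :=
  ∀ X ∈ C, ∀ Y ∈ C, (X \ Y).card ≤ 1 → (Y \ X).card ≤ 1 → X = Y

/-- The `M♮`-exchange property of a set function. -/
def HasExchangeProperty {K : ℕ} (v : BundleFun K) : Prop :=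
  ∀ A B : Finset (Fin K), ∀ i ∈ A \ B,
    v A + v B ≤ v (A.erase i) + v (insert i B) ∨
    ∃ j ∈ B \ A, v A + v B ≤ v (insert j (A.erase i)) + v (insert i (B.erase j))

/-! ### Exchange property and substitutes -/

theorem HasExchangeProperty.hasSubstituteProperty {K : ℕ} {v : BundleFun K}
    (hv : HasExchangeProperty v) : HasSubstituteProperty v := by
  classical
  intro p q _ hpq A hA
  set E : Finset (Fin K) := A.filter (fun k => p k = q k) with hE
  obtain ⟨M, -, hM⟩ := Finset.exists_max_image (Finset.univ : Finset (Finset (Fin K)))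
    (fun B => v B - ∑ k ∈ B, q k) Finset.univ_nonempty
  -- `B` has maximal overlap with `E` among bundles demanded at `q`. If it missed `i ∈ E`,
  -- optimality of `A` at `p`, with `p i = q i` and `p j ≤ q j`, would make the exchanged `B`
  -- demanded too, with larger overlap.
  obtain ⟨B, hB, hBmax⟩ := Finset.exists_max_image
    (Finset.univ.filter (fun B => B ∈ demand v q)) (fun B => (E ∩ B).card)
    ⟨M, by simpa [demand] using fun B => hM B (Finset.mem_univ B)⟩
  simp only [Finset.mem_filter, Finset.mem_univ, true_and] at hB hBmax
  refine ⟨B, hB, fun i hiA hi => ?_⟩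
  by_contra hiB
  have hiE : i ∈ E := by simp [hE, hiA, hi]
  have sA : ∑ k ∈ A.erase i, p k + p i = ∑ k ∈ A, p k := Finset.sum_erase_add _ _ hiA
  rcases hv A B i (by simp [hiA, hiB]) with h | ⟨j, hj, h⟩
  · have sB : ∑ k ∈ insert i B, q k = q i + ∑ k ∈ B, q k := Finset.sum_insert hiB
    have h1 := hA (A.erase i)
    have hD : insert i B ∈ demand v q := fun D => by
      have := hB D
      linarith
    have hlt := hBmax _ hD
    have : E ∩ B ⊂ E ∩ insert i B := by
      rw [Finset.ssubset_iff]
      exact ⟨i, by simp [hiB], by intro x; simp; grind⟩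
    exact absurd (Finset.card_lt_card this) (not_lt.2 hlt)
  · rw [Finset.mem_sdiff] at hj
    have hij : i ≠ j := by rintro rfl; exact hiB hj.1
    have sA' : ∑ k ∈ insert j (A.erase i), p k = p j + ∑ k ∈ A.erase i, p k :=
      Finset.sum_insert (by simp [hj.2])
    have sB : ∑ k ∈ insert i (B.erase j), q k = q i + ∑ k ∈ B.erase j, q k :=
      Finset.sum_insert (by simp [hiB])
    have sB' : ∑ k ∈ B.erase j, q k + q j = ∑ k ∈ B, q k := Finset.sum_erase_add _ _ hj.1
    have h1 := hA (insert j (A.erase i))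
    have hD : insert i (B.erase j) ∈ demand v q := fun D => by
      have := hB D
      have := hpq j
      linarith
    have hlt := hBmax _ hD
    have : E ∩ B ⊂ E ∩ insert i (B.erase j) := by
      rw [Finset.ssubset_iff]
      refine ⟨i, by simp [hiB], ?_⟩
      intro x hx
      have hjE : j ∉ E := by simp [hE, hj.2]
      simp only [Finset.mem_insert, Finset.mem_inter, Finset.mem_erase] at hx ⊢
      grind
    exact absurd (Finset.card_lt_card this) (not_lt.2 hlt)

theorem HasExchangeProperty.modular_add {K : ℕ} {v : BundleFun K} (hv : HasExchangeProperty v)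
    (a : Fin K → ℝ) : HasExchangeProperty (fun A => ∑ k ∈ A, a k + v A) := by
  intro A B i hi
  rw [Finset.mem_sdiff] at hi
  have sA : ∑ k ∈ A.erase i, a k + a i = ∑ k ∈ A, a k := Finset.sum_erase_add _ _ hi.1
  rcases hv A B i (by simp [hi]) with h | ⟨j, hj, h⟩
  · left
    have sB : ∑ k ∈ insert i B, a k = a i + ∑ k ∈ B, a k := Finset.sum_insert hi.2
    linarith
  · right
    refine ⟨j, hj, ?_⟩
    rw [Finset.mem_sdiff] at hj
    have sA' : ∑ k ∈ insert j (A.erase i), a k = a j + ∑ k ∈ A.erase i, a k :=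
      Finset.sum_insert (by simp [hj.2])
    have sB : ∑ k ∈ insert i (B.erase j), a k = a i + ∑ k ∈ B.erase j, a k :=
      Finset.sum_insert (by simp [hi.2])
    have sB' : ∑ k ∈ B.erase j, a k + a j = ∑ k ∈ B, a k := Finset.sum_erase_add _ _ hj.1
    linarith

theorem Finset.card_le_two_of_forall_or {α : Type*} {T : Finset α} {P Q : α → Prop}
    (h : ∀ j ∈ T, P j ∨ Q j) (hP : ∀ j ∈ T, ∀ l ∈ T, P j → P l → j = l)
    (hQ : ∀ j ∈ T, ∀ l ∈ T, Q j → Q l → j = l) : T.card ≤ 2 := by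
  classical
  have hT : T ⊆ T.filter P ∪ T.filter Q := fun j hj => by
    have := h j hj
    simp [hj, this]
  have h1 : (T.filter P).card ≤ 1 := Finset.card_le_one.2 (by simp; grind)
  have h2 : (T.filter Q).card ≤ 1 := Finset.card_le_one.2 (by simp; grind)
  have := Finset.card_le_card hT
  have := Finset.card_union_le (T.filter P) (T.filter Q)
  omega

/-! ### Exchanges avoiding an asymmetric code -/

section Exchange

variable {α : Type*} [DecidableEq α] {C : Finset (Finset α)}

theorem IsAsymmetricCode.eq_of_subset_insert (hC : IsAsymmetricCode C) {X Y : Finset α} {x y : α}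
    (hX : X ∈ C) (hY : Y ∈ C) (h1 : X ⊆ insert x Y) (h2 : Y ⊆ insert y X) : X = Y := by
  refine hC X hX Y hY ((Finset.card_le_card (t := {x}) ?_).trans (by simp))
    ((Finset.card_le_card (t := {y}) ?_).trans (by simp))
  · intro z hz
    have := @h1 z
    simp at hz this ⊢
    tauto
  · intro z hz
    have := @h2 z
    simp at hz this ⊢
    tauto

theorem IsAsymmetricCode.eq_of_insert_mem (hC : IsAsymmetricCode C) {S : Finset α} {j l : α}
    (hj : j ∉ S) (h1 : insert j S ∈ C) (h2 : insert l S ∈ C) : j = l := by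
  have h := hC.eq_of_subset_insert (x := j) (y := l) h1 h2 (by grind) (by grind)
  have hj' : j ∈ insert l S := h ▸ Finset.mem_insert_self _ _
  grind

theorem IsAsymmetricCode.eq_of_insert_erase_mem (hC : IsAsymmetricCode C) {B : Finset α}
    {i j l : α} (hj : j ∈ B) (hi : i ∉ B) (h1 : insert i (B.erase j) ∈ C)
    (h2 : insert i (B.erase l) ∈ C) : j = l := by
  have h := hC.eq_of_subset_insert (x := l) (y := j) h1 h2 (by grind) (by grind)
  by_contra hne
  have hj' : j ∈ insert i (B.erase j) := by rw [h]; grind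
  grind

theorem IsAsymmetricCode.insert_notMem (hC : IsAsymmetricCode C) {S : Finset α} {j : α}
    (hj : j ∉ S) (h : S ∈ C) : insert j S ∉ C := by
  intro h2
  have h := hC.eq_of_subset_insert (x := j) (y := j) h h2 (by grind) (by grind)
  exact hj (h ▸ Finset.mem_insert_self _ _)

/-- Two words that differ by `i` on one side and by at most one element on the other
are not both codewords. -/
theorem IsAsymmetricCode.notMem_of_sdiff_subset (hC : IsAsymmetricCode C) {X Y D : Finset α}
    {i : α} (hX : X ∈ C) (hiX : i ∉ X) (hiY : i ∈ Y) (hXY : X \ Y ⊆ D) (hD : D.card ≤ 1)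
    (hYX : Y \ X ⊆ {i}) : Y ∉ C := by
  intro hY
  have h := hC X hX Y hY ((Finset.card_le_card hXY).trans hD)
    ((Finset.card_le_card hYX).trans (by simp))
  exact hiX (h ▸ hiY)

/-- Exchanges along `j ∈ B \ A` avoid the code, or are trivial, when `|A| ≤ |B|`. -/
theorem IsAsymmetricCode.exists_swap (hC : IsAsymmetricCode C) {A B : Finset α} {i : α}
    (hiA : i ∈ A) (hiB : i ∉ B) (hcard : (A \ B).card ≤ (B \ A).card) :
    ∃ j ∈ B \ A, (insert j (A.erase i) = B ∧ insert i (B.erase j) = A) ∨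
      (insert j (A.erase i) ∉ C ∧ insert i (B.erase j) ∉ C) := by
  by_contra! hcon
  have hpos : 0 < (A \ B).card := Finset.card_pos.2 ⟨i, by simp [hiA, hiB]⟩
  have hXX : ∀ j ∈ B \ A, ∀ l ∈ B \ A, insert j (A.erase i) ∈ C → insert l (A.erase i) ∈ C →
      j = l := fun j hj l _ => hC.eq_of_insert_mem (by simp at hj; simp [hj.2])
  have hYY : ∀ j ∈ B \ A, ∀ l ∈ B \ A, insert i (B.erase j) ∈ C → insert i (B.erase l) ∈ C →
      j = l := fun j hj l _ => hC.eq_of_insert_erase_mem (Finset.mem_sdiff.1 hj).1 hiB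
  have hor : ∀ j ∈ B \ A, insert j (A.erase i) ∈ C ∨ insert i (B.erase j) ∈ C := fun j hj => by
    have := (hcon j hj).2
    tauto
  -- Every `j` is blocked by one of two codeword memberships, and each kind occurs for at most one
  -- `j`.
  have h2 := Finset.card_le_two_of_forall_or hor hXX hYY
  have hcases : (B \ A).card = 1 ∨ (B \ A).card = 2 := by omega
  rcases hcases with h1 | h2
  · obtain ⟨j, hj⟩ := Finset.card_eq_one.1 h1
    obtain ⟨i', hi'⟩ := Finset.card_eq_one.1 (show (A \ B).card = 1 by omega)
    have hjm : ∀ x, (x ∈ B ∧ x ∉ A) ↔ x = j := fun x => by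
      rw [← Finset.mem_sdiff, hj, Finset.mem_singleton]
    have him : ∀ x, (x ∈ A ∧ x ∉ B) ↔ x = i := fun x => by
      have : i = i' := by rw [← Finset.mem_singleton, ← hi']; simp [hiA, hiB]
      rw [← Finset.mem_sdiff, hi', Finset.mem_singleton, this]
    refine (hcon j (by simp [hj])).1 ?_ ?_
    · ext x
      have := hjm x; have := him x
      grind
    · ext x
      have := hjm x; have := him x
      grind
  -- The two elements must be blocked in different ways, but those two codewords would be too close.
  · have hD : ((A \ B).erase i).card ≤ 1 := by
      rw [Finset.card_erase_of_mem (by simp [hiA, hiB])]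
      omega
    have hXY : ∀ j ∈ B \ A, ∀ l ∈ B \ A, j ≠ l → insert j (A.erase i) ∈ C →
        insert i (B.erase l) ∉ C := by
      intro j hj l hl hne h1
      have hBA : B \ A = {j, l} := (Finset.eq_of_subset_of_card_le (by grind)
        (by rw [Finset.card_pair hne]; omega)).symm
      refine hC.notMem_of_sdiff_subset h1 (by grind) (Finset.mem_insert_self _ _)
        (show _ ⊆ (A \ B).erase i by grind) hD fun x hx => ?_
      have : x ∈ B \ A ↔ x = j ∨ x = l := by rw [hBA]; simp
      grind
    obtain ⟨j, l, hne, hjl⟩ := Finset.card_eq_two.1 h2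
    have hj : j ∈ B \ A := by simp [hjl]
    have hl : l ∈ B \ A := by simp [hjl]
    have := hXY j hj l hl hne
    have := hXY l hl j hj hne.symm
    have := hXX j hj l hl
    have := hYY j hj l hl
    have := hor j hj
    have := hor l hl
    tauto

/-- Exchanges, possibly without compensation, avoid the code, or are trivial,
when `|A| = |B| + 1`. -/
theorem IsAsymmetricCode.exists_swap_or_move (hC : IsAsymmetricCode C) {A B : Finset α} {i : α}
    (hiA : i ∈ A) (hiB : i ∉ B) (hcard : (A \ B).card = (B \ A).card + 1) :
    ((A.erase i = B ∧ insert i B = A) ∨ (A.erase i ∉ C ∧ insert i B ∉ C)) ∨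
    ∃ j ∈ B \ A, insert j (A.erase i) ∉ C ∧ insert i (B.erase j) ∉ C := by
  by_contra! hcon
  obtain ⟨⟨htriv, hmove⟩, hswap⟩ := hcon
  have hne : (B \ A).Nonempty := by
    rw [Finset.nonempty_iff_ne_empty]
    intro h0
    rw [h0, Finset.card_empty] at hcard
    obtain ⟨i', hi'⟩ := Finset.card_eq_one.1 hcard
    have hBA := Finset.sdiff_eq_empty_iff_subset.1 h0
    have him : ∀ x, (x ∈ A ∧ x ∉ B) ↔ x = i := fun x => by
      have : i = i' := by rw [← Finset.mem_singleton, ← hi']; simp [hiA, hiB]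
      rw [← Finset.mem_sdiff, hi', Finset.mem_singleton, this]
    refine htriv ?_ ?_
    · ext x
      have := him x; have := @hBA x
      grind
    · ext x
      have := him x; have := @hBA x
      grind
  have hX : ∀ j ∈ B \ A, A.erase i ∈ C → insert j (A.erase i) ∉ C := fun j hj =>
    hC.insert_notMem (by simp at hj; simp [hj.2])
  have hY : ∀ j ∈ B \ A, insert i B ∈ C → insert i (B.erase j) ∉ C := by
    intro j hj h1 h2
    have hjB := (Finset.mem_sdiff.1 hj).1
    refine hC.insert_notMem (j := j) (by grind) h2 ?_
    rwa [Finset.insert_comm, Finset.insert_erase hjB]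
  have hXX : ∀ j ∈ B \ A, ∀ l ∈ B \ A, insert j (A.erase i) ∈ C → insert l (A.erase i) ∈ C →
      j = l := fun j hj l _ => hC.eq_of_insert_mem (by simp at hj; simp [hj.2])
  have hYY : ∀ j ∈ B \ A, ∀ l ∈ B \ A, insert i (B.erase j) ∈ C → insert i (B.erase l) ∈ C →
      j = l := fun j hj l _ => hC.eq_of_insert_erase_mem (Finset.mem_sdiff.1 hj).1 hiB
  have hone : (B \ A).card = 1 := by
    refine le_antisymm (Finset.card_le_one.2 fun j hj l hl => ?_) hne.card_pos
    have hXj := hX j hj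
    have hXl := hX l hl
    have hYj := hY j hj
    have hYl := hY l hl
    have hsj := hswap j hj
    have hsl := hswap l hl
    -- The plain move is blocked too. Whichever of `A.erase i`, `insert i B` is a codeword excludes
    -- one kind of block, so all `j` are blocked in the same way and coincide.
    by_cases h0 : A.erase i ∈ C
    · exact hYY j hj l hl (hsj (hXj h0)) (hsl (hXl h0))
    · have h0' := hmove h0
      refine hXX j hj l hl ?_ ?_
      · by_contra h
        exact hYj h0' (hsj h)
      · by_contra h
        exact hYl h0' (hsl h)
  obtain ⟨j, hj⟩ := Finset.card_eq_one.1 hone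
  have hjm : ∀ x, (x ∈ B ∧ x ∉ A) ↔ x = j := fun x => by
    rw [← Finset.mem_sdiff, hj, Finset.mem_singleton]
  have hjBA : j ∈ B \ A := by simp [hj]
  have hD : ((A \ B).erase i).card ≤ 1 := by
    rw [Finset.card_erase_of_mem (by simp [hiA, hiB])]
    omega
  have h1 : A.erase i ∈ C → insert i (B.erase j) ∉ C := fun h1 =>
    hC.notMem_of_sdiff_subset h1 (by grind) (Finset.mem_insert_self _ _)
      (show _ ⊆ (A \ B).erase i by grind) hD fun x hx => by
        have := hjm x
        grind
  have h2 : insert j (A.erase i) ∈ C → insert i B ∉ C := fun h1 =>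
    hC.notMem_of_sdiff_subset h1 (by grind) (Finset.mem_insert_self _ _)
      (show _ ⊆ (A \ B).erase i by grind) hD fun x hx => by
        have := hjm x
        grind
  have h3 := hX j hjBA
  have h4 := hY j hjBA
  have h5 := hswap j hjBA
  tauto

end Exchange

/-- A strongly concave function of the cardinality, lowered slightly on the words of an
asymmetric code, has the exchange property. -/
theorem IsAsymmetricCode.hasExchangeProperty {K : ℕ} {C : Finset (Finset (Fin K))}
    (hC : IsAsymmetricCode C) {g : ℕ → ℝ}
    (hg : ∀ a b, b + 2 ≤ a → a ≤ K → g a + g b + 2 ≤ g (a - 1) + g (b + 1))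
    {w : BundleFun K} (hw0 : ∀ A, 0 ≤ w A) (hw1 : ∀ A, w A ≤ 1) (hwC : ∀ A, A ∉ C → w A = 0) :
    HasExchangeProperty (fun A => g A.card - w A) := by
  intro A B i hi
  rw [Finset.mem_sdiff] at hi
  obtain ⟨hiA, hiB⟩ := hi
  have hcA := Finset.card_sdiff_add_card_inter A B
  have hcB := Finset.card_sdiff_add_card_inter B A
  rw [Finset.inter_comm] at hcB
  have cX : (A.erase i).card = A.card - 1 := Finset.card_erase_of_mem hiA
  have cY : (insert i B).card = B.card + 1 := Finset.card_insert_of_notMem hiB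
  have hApos : 0 < A.card := Finset.card_pos.2 ⟨i, hiA⟩
  have cXj : ∀ j ∈ B \ A, (insert j (A.erase i)).card = A.card := fun j hj => by
    rw [Finset.card_insert_of_notMem (by simp at hj; simp [hj.2]), cX]
    omega
  have cYj : ∀ j ∈ B \ A, (insert i (B.erase j)).card = B.card := fun j hj => by
    rw [Finset.mem_sdiff] at hj
    have : 0 < B.card := Finset.card_pos.2 ⟨j, hj.1⟩
    rw [Finset.card_insert_of_notMem (by simp [hiB]), Finset.card_erase_of_mem hj.1]
    omega
  have hA0 := hw0 A
  have hB0 := hw0 B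
  dsimp only
  -- A swap preserves both cardinalities, and a move interchanges them when `|A| = |B| + 1`. Beyond
  -- that, the concavity gain 2 pays for two penalties of at most 1.
  rcases lt_trichotomy A.card (B.card + 1) with hlt | heq | hgt
  · obtain ⟨j, hj, h⟩ := hC.exists_swap hiA hiB (by omega)
    refine Or.inr ⟨j, hj, ?_⟩
    rcases h with ⟨h1, h2⟩ | ⟨h1, h2⟩
    · rw [h1, h2]
      linarith
    · rw [hwC _ h1, hwC _ h2, cXj j hj, cYj j hj]
      linarith
  · rcases hC.exists_swap_or_move hiA hiB (by omega) with (⟨h1, h2⟩ | ⟨h1, h2⟩) | ⟨j, hj, h1, h2⟩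
    · left
      rw [h1, h2]
      linarith
    · left
      rw [hwC _ h1, hwC _ h2, cX, cY, heq, Nat.add_sub_cancel]
      linarith
    · refine Or.inr ⟨j, hj, ?_⟩
      rw [hwC _ h1, hwC _ h2, cXj j hj, cYj j hj]
      linarith
  · left
    have hK : A.card ≤ K := by simpa using Finset.card_le_univ A
    have := hg A.card B.card (by omega) hK
    rw [cX, cY]
    have := hw1 (A.erase i)
    have := hw1 (insert i B)
    linarith

/-! ### Polyhedra and their linear images -/

theorem isPolyhedron_of_forall_le {E ι : Type*} [AddCommGroup E] [Module ℝ E] [Finite ι]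
    (a : ι → E →ₗ[ℝ] ℝ) (b : ι → ℝ) (hne : {x | ∀ i, a i x ≤ b i}.Nonempty) :
    IsPolyhedron {x | ∀ i, a i x ≤ b i} := by
  -- Zero forms define no half-space; nonemptiness makes their constraints vacuous, so they are
  -- dropped.
  refine ⟨hne, (fun i => {x | a i x ≤ b i}) '' {i | a i ≠ 0}, Set.toFinite _, ?_, ?_⟩
  · rintro _ ⟨i, hi, rfl⟩
    exact ⟨a i, b i, hi, rfl⟩
  · obtain ⟨y, hy⟩ := hne
    ext x
    simp only [Set.mem_ofPred_eq, Set.sInter_image, Set.mem_iInter]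
    refine ⟨fun h i _ => h i, fun h i => ?_⟩
    by_cases hi : a i = 0
    · have := hy i
      simpa [hi] using this
    · exact h i hi

/-- The image of a polyhedron under an injective linear map to `ℝ^β`. -/
theorem isPolyhedron_image {V β ι : Type*} [AddCommGroup V] [Module ℝ V] [Finite β] [Finite ι]
    (Φ : V →ₗ[ℝ] (β → ℝ)) (hΦ : Function.Injective Φ) (a : ι → V →ₗ[ℝ] ℝ) (b : ι → ℝ)
    (hne : {x | ∀ i, a i x ≤ b i}.Nonempty) :
    IsPolyhedron (Φ '' {x | ∀ i, a i x ≤ b i}) := by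
  obtain ⟨Ψ, hΨ⟩ := Φ.exists_leftInverse_of_injective (LinearMap.ker_eq_bot.2 hΦ)
  have hΨ' : ∀ x, Ψ (Φ x) = x := fun x => LinearMap.congr_fun hΨ x
  -- `R` vanishes exactly on the range of `Φ`; each coordinate equation is encoded as two
  -- inequalities.
  let R : (β → ℝ) →ₗ[ℝ] (β → ℝ) := Φ ∘ₗ Ψ - LinearMap.id
  let a' : (β ⊕ β) ⊕ ι → (β → ℝ) →ₗ[ℝ] ℝ :=
    Sum.elim (Sum.elim (fun t => LinearMap.proj t ∘ₗ R) (fun t => -(LinearMap.proj t ∘ₗ R)))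
      (fun i => a i ∘ₗ Ψ)
  let b' : (β ⊕ β) ⊕ ι → ℝ := Sum.elim (fun _ => 0) b
  have key : Φ '' {x | ∀ i, a i x ≤ b i} = {y | ∀ s, a' s y ≤ b' s} := by
    ext y
    constructor
    · rintro ⟨x, hx, rfl⟩ ((t | t) | i)
      · simp [a', b', R, hΨ']
      · simp [a', b', R, hΨ']
      · simpa [a', b', hΨ'] using hx i
    · intro hy
      refine ⟨Ψ y, fun i => by simpa [a', b'] using hy (Sum.inr i), ?_⟩
      ext t
      have h1 := hy (Sum.inl (Sum.inl t))
      have h2 := hy (Sum.inl (Sum.inr t))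
      simp [a', b', R] at h1 h2
      exact le_antisymm h1 h2
  rw [key]
  exact isPolyhedron_of_forall_le a' b' (key ▸ hne.image Φ)

/-- If the strict inequalities are feasible, the polyhedron has full dimension, and injective
linear maps preserve it. -/
theorem polyhedronDim_image {V E ι : Type*} [NormedAddCommGroup V] [NormedSpace ℝ V]
    [FiniteDimensional ℝ V] [AddCommGroup E] [Module ℝ E] [Finite ι]
    (Φ : V →ₗ[ℝ] E) (hΦ : Function.Injective Φ) (a : ι → V →ₗ[ℝ] ℝ) (b : ι → ℝ)
    (hne : {x | ∀ i, a i x < b i}.Nonempty) :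
    polyhedronDim (Φ '' {x | ∀ i, a i x ≤ b i}) = Module.finrank ℝ V := by
  have hopen : IsOpen {x | ∀ i, a i x < b i} := by
    rw [Set.ofPred_forall]
    exact isOpen_iInter_of_finite fun i =>
      isOpen_lt (LinearMap.continuous_of_finiteDimensional _) continuous_const
  have htop : affineSpan ℝ {x | ∀ i, a i x ≤ b i} = ⊤ :=
    top_le_iff.1 ((hopen.affineSpan_eq_top hne).ge.trans
      (affineSpan_mono ℝ fun x hx i => (hx i).le))
  have hmap := AffineSubspace.map_span Φ.toAffineMap {x | ∀ i, a i x ≤ b i}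
  rw [polyhedronDim, ← LinearMap.coe_toAffineMap, ← hmap, htop, AffineSubspace.map_direction,
    AffineSubspace.direction_top, LinearMap.toAffineMap_linear, Submodule.map_top,
    LinearMap.finrank_range_of_inj hΦ]

/-! ### Codes from a congruence -/

/-- `X \ Y` and `Y \ X` have equal weight. The weights `1, …, K` are nonzero and distinct modulo `K
+ 1`, so two differences of size at most 1 must both be empty. -/
theorem isAsymmetricCode_of_sum_eq {K : ℕ} {C : Finset (Finset (Fin K))} {c : ZMod (K + 1)}
    (h : ∀ A ∈ C, ∑ i ∈ A, (((i : ℕ) + 1 : ℕ) : ZMod (K + 1)) = c) : IsAsymmetricCode C := by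
  intro X hX Y hY h1 h2
  have hlt : ∀ i : Fin K, (i : ℕ) + 1 < K + 1 := fun i => by omega
  have hinj : ∀ i j : Fin K, (((i : ℕ) + 1 : ℕ) : ZMod (K + 1)) = (((j : ℕ) + 1 : ℕ)) → i = j := by
    intro i j hij
    have := congrArg ZMod.val hij
    rw [ZMod.val_natCast_of_lt (hlt i), ZMod.val_natCast_of_lt (hlt j)] at this
    exact Fin.ext (by omega)
  have hne : ∀ i : Fin K, (((i : ℕ) + 1 : ℕ) : ZMod (K + 1)) ≠ 0 := by
    intro i hi
    have := congrArg ZMod.val hi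
    rw [ZMod.val_natCast_of_lt (hlt i), ZMod.val_zero] at this
    omega
  have hsum : ∑ i ∈ X \ Y, (((i : ℕ) + 1 : ℕ) : ZMod (K + 1)) =
      ∑ i ∈ Y \ X, (((i : ℕ) + 1 : ℕ) : ZMod (K + 1)) := by
    have e1 := Finset.sum_inter_add_sum_sdiff X Y fun i => (((i : ℕ) + 1 : ℕ) : ZMod (K + 1))
    have e2 := Finset.sum_inter_add_sum_sdiff Y X fun i => (((i : ℕ) + 1 : ℕ) : ZMod (K + 1))
    rw [Finset.inter_comm, h X hX, ← h Y hY, ← e2] at e1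
    exact add_left_cancel e1
  rcases Finset.eq_empty_or_nonempty (X \ Y) with hXY | hXY <;>
    rcases Finset.eq_empty_or_nonempty (Y \ X) with hYX | hYX
  · exact (Finset.sdiff_eq_empty_iff_subset.1 hXY).antisymm
      (Finset.sdiff_eq_empty_iff_subset.1 hYX)
  · obtain ⟨y, hy⟩ := Finset.card_eq_one.1 (le_antisymm h2 hYX.card_pos)
    rw [hXY, hy, Finset.sum_empty, Finset.sum_singleton] at hsum
    exact absurd hsum.symm (hne y)
  · obtain ⟨x, hx⟩ := Finset.card_eq_one.1 (le_antisymm h1 hXY.card_pos)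
    rw [hYX, hx, Finset.sum_empty, Finset.sum_singleton] at hsum
    exact absurd hsum (hne x)
  · obtain ⟨x, hx⟩ := Finset.card_eq_one.1 (le_antisymm h1 hXY.card_pos)
    obtain ⟨y, hy⟩ := Finset.card_eq_one.1 (le_antisymm h2 hYX.card_pos)
    rw [hx, hy, Finset.sum_singleton, Finset.sum_singleton] at hsum
    have hxy := hinj x y hsum
    have hx' : x ∈ X \ Y := by simp [hx]
    have hy' : y ∈ Y \ X := by simp [hy]
    rw [hxy, Finset.mem_sdiff] at hx'
    exact absurd hx'.1 (Finset.mem_sdiff.1 hy').2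

theorem two_pow_le_card_filter_add (K : ℕ) : 2 ^ K ≤
    (Finset.univ.filter fun A : Finset (Fin K) => 2 ≤ A.card ∧ A.card < K).card + (K + 2) := by
  classical
  have h : (Finset.univ : Finset (Finset (Fin K))) ⊆
      (Finset.univ.filter fun A : Finset (Fin K) => 2 ≤ A.card ∧ A.card < K) ∪
        (Finset.univ.image (fun i : Fin K => ({i} : Finset (Fin K))) ∪ {∅, Finset.univ}) := by
    intro A _
    by_cases hK : A.card < K
    · by_cases h2 : 2 ≤ A.card
      · simp [hK, h2]
      · rcases (show A.card = 0 ∨ A.card = 1 by omega) with h | h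
        · simp [Finset.card_eq_zero.1 h]
        · obtain ⟨a, rfl⟩ := Finset.card_eq_one.1 h
          simp
    · have : A = Finset.univ := Finset.eq_univ_of_card A
        (le_antisymm (Finset.card_le_univ A) (by simpa using hK))
      simp [this]
  have h1 := Finset.card_le_card h
  have h2 := Finset.card_union_le
    (Finset.univ.filter fun A : Finset (Fin K) => 2 ≤ A.card ∧ A.card < K)
    (Finset.univ.image (fun i : Fin K => ({i} : Finset (Fin K))) ∪ {∅, Finset.univ})
  have h3 := Finset.card_union_le (Finset.univ.image (fun i : Fin K => ({i} : Finset (Fin K))))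
    {∅, Finset.univ}
  have h4 := Finset.card_image_le (s := Finset.univ) (f := fun i : Fin K => ({i} : Finset (Fin K)))
  have h5 := Finset.card_le_two (a := (∅ : Finset (Fin K))) (b := Finset.univ)
  simp only [Finset.card_univ, Fintype.card_finset, Fintype.card_fin] at h1 h4
  omega

theorem exists_isAsymmetricCode {K n : ℕ} (hn : (K + 1) * n + 1 < 2 ^ K) :
    ∃ C : Finset (Finset (Fin K)), IsAsymmetricCode C ∧ (∀ A ∈ C, 2 ≤ A.card ∧ A.card < K) ∧
      C.card = n := by
  classical
  rcases n with _ | m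
  · exact ⟨∅, by simp [IsAsymmetricCode], by simp, rfl⟩
  have h := two_pow_le_card_filter_add K
  obtain ⟨c, -, hc⟩ := Finset.exists_lt_card_fiber_of_mul_lt_card_of_maps_to
    (s := Finset.univ.filter fun A : Finset (Fin K) => 2 ≤ A.card ∧ A.card < K)
    (t := (Finset.univ : Finset (ZMod (K + 1)))) (n := m)
    (f := fun A => ∑ i ∈ A, (((i : ℕ) + 1 : ℕ) : ZMod (K + 1)))
    (fun _ _ => Finset.mem_univ _)
    (by rw [Finset.card_univ, ZMod.card]; rw [mul_add] at hn; omega)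
  obtain ⟨C, hCsub, hCcard⟩ := Finset.exists_subset_card_eq (Nat.succ_le_of_lt hc)
  refine ⟨C, isAsymmetricCode_of_sum_eq (c := c) fun A hA => ?_, fun A hA => ?_, hCcard⟩
  · exact (Finset.mem_filter.1 (hCsub hA)).2
  · exact (Finset.mem_filter.1 (Finset.mem_filter.1 (hCsub hA)).1).2

/-! ### The parametrized family of valuations -/

section Construction

variable {K : ℕ} (C : Finset (Finset (Fin K)))

/-- The parameters of a valuation: prices of the goods, values of the cardinalities `2, …, K`,
and penalties of the codewords. -/
abbrev ValuationParam : Type := (Fin K → ℝ) × (Fin (K - 1) → ℝ) × (C → ℝ)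

/-- The value that the parameters give to a cardinality; it is zero at `0` and `1`. -/
noncomputable def levelValue (n : ℕ) : ValuationParam C →ₗ[ℝ] ℝ :=
  if h : 2 ≤ n ∧ n ≤ K then
    LinearMap.proj (⟨n - 2, by omega⟩ : Fin (K - 1)) ∘ₗ LinearMap.fst ℝ _ _ ∘ₗ LinearMap.snd ℝ _ _
  else 0

/-- The penalty of a bundle; it is zero outside the code. -/
noncomputable def codePenalty (A : Finset (Fin K)) : ValuationParam C →ₗ[ℝ] ℝ :=
  if h : A ∈ C then
    LinearMap.proj (⟨A, h⟩ : C) ∘ₗ LinearMap.snd ℝ _ _ ∘ₗ LinearMap.snd ℝ _ _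
  else 0

/-- The valuation with given parameters. -/
noncomputable def paramValuation : ValuationParam C →ₗ[ℝ] (Finset (Fin K) → ℝ) :=
  LinearMap.pi fun A =>
    (∑ k ∈ A, LinearMap.proj k) ∘ₗ LinearMap.fst ℝ _ _ + (levelValue C A.card - codePenalty C A)

theorem paramValuation_apply (x : ValuationParam C) (A : Finset (Fin K)) :
    paramValuation C x A =
      ∑ k ∈ A, x.1 k + (levelValue C A.card x - codePenalty C A x) := by
  simp [paramValuation]

theorem levelValue_of_lt {n : ℕ} (hn : n < 2) : levelValue C n = 0 :=
  dif_neg (by omega)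

theorem codePenalty_of_notMem {A : Finset (Fin K)} (hA : A ∉ C) : codePenalty C A = 0 :=
  dif_neg hA

/-- Two `n`-subsets of an `(n + 1)`-set cannot both be codewords. Thus each level has an unpenalized
bundle from which its value can be read off. -/
theorem exists_card_eq_notMem {C : Finset (Finset (Fin K))} (hC : IsAsymmetricCode C) {n : ℕ}
    (h1 : 1 ≤ n) (h2 : n < K) : ∃ A : Finset (Fin K), A.card = n ∧ A ∉ C := by
  obtain ⟨B, -, hB⟩ := Finset.exists_subset_card_eq
    (show n + 1 ≤ (Finset.univ : Finset (Fin K)).card by simpa using h2)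
  obtain ⟨x, hx, y, hy, hxy⟩ := Finset.one_lt_card.1 (show 1 < B.card by omega)
  by_contra! hcon
  have ex := hcon (B.erase x) (by rw [Finset.card_erase_of_mem hx]; omega)
  have ey := hcon (B.erase y) (by rw [Finset.card_erase_of_mem hy]; omega)
  have h := hC.eq_of_subset_insert (x := y) (y := x) ex ey (by grind) (by grind)
  have : x ∈ B.erase x := by rw [h]; grind
  grind

/-- Singletons determine the prices, non-codewords then determine the levels, and codewords finally
the penalties. -/
theorem paramValuation_injective {C : Finset (Finset (Fin K))} (hC : IsAsymmetricCode C)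
    (hcard : ∀ A ∈ C, 2 ≤ A.card ∧ A.card < K) : Function.Injective (paramValuation C) := by
  refine (injective_iff_map_eq_zero _).2 fun x hx => ?_
  have hxA : ∀ A : Finset (Fin K),
      ∑ k ∈ A, x.1 k + (levelValue C A.card x - codePenalty C A x) = 0 := fun A => by
    rw [← paramValuation_apply, hx, Pi.zero_apply]
  have h1 : ∀ k, x.1 k = 0 := fun k => by
    have h := hxA {k}
    rw [codePenalty_of_notMem C (fun hk => by simpa using (hcard _ hk).1),
      levelValue_of_lt C (by simp)] at h
    simpa using h
  have h2 : ∀ n, 2 ≤ n → n ≤ K → levelValue C n x = 0 := fun n hn hnK => by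
    obtain ⟨A, hA, hAC⟩ : ∃ A : Finset (Fin K), A.card = n ∧ A ∉ C := by
      rcases hnK.lt_or_eq with h | h
      · exact exists_card_eq_notMem hC (by omega) h
      · exact ⟨Finset.univ, by simp [h], fun hu => by simpa using (hcard _ hu).2⟩
    have h := hxA A
    rw [codePenalty_of_notMem C hAC, hA] at h
    simpa [h1] using h
  have h3 : ∀ A ∈ C, codePenalty C A x = 0 := fun A hA => by
    have h := hxA A
    rw [h2 _ (hcard A hA).1 (hcard A hA).2.le] at h
    simpa [h1] using h
  refine Prod.ext (funext h1) (Prod.ext (funext fun i => ?_) (funext fun A => ?_))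
  · have h := h2 (i + 2) (by omega) (by omega)
    rw [levelValue, dif_pos (by omega)] at h
    simpa using h
  · have h := h3 A A.2
    rw [codePenalty, dif_pos A.2] at h
    simpa using h

theorem finrank_valuationParam (hK : 2 ≤ K) :
    Module.finrank ℝ (ValuationParam C) = 2 * K - 1 + C.card := by
  simp only [ValuationParam, Module.finrank_prod, Module.finrank_fintype_fun_eq_card,
    Fintype.card_fin, Fintype.card_coe]
  omega

/-- The index set of the constraints: lower and upper bounds of the penalties, concavity, and
monotonicity. -/
abbrev ConstraintIndex : Type :=
  (C ⊕ C) ⊕ ({s : Fin (K + 1) × Fin (K + 1) // (s.2 : ℕ) + 2 ≤ s.1} ⊕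
    {s : Finset (Fin K) × Finset (Fin K) // s.1 ⊂ s.2})

/-- The linear forms of the constraints. -/
noncomputable def constraintForm : ConstraintIndex C → ValuationParam C →ₗ[ℝ] ℝ :=
  Sum.elim (Sum.elim (fun A => -codePenalty C A) fun A => codePenalty C A)
    (Sum.elim
      (fun s => levelValue C s.1.1 + levelValue C s.1.2 -
        (levelValue C (s.1.1 - 1) + levelValue C (s.1.2 + 1)))
      fun s => LinearMap.proj s.1.1 ∘ₗ paramValuation C - LinearMap.proj s.1.2 ∘ₗ paramValuation C)

/-- The right-hand sides of the constraints. -/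
noncomputable def constraintBound : ConstraintIndex C → ℝ :=
  Sum.elim (Sum.elim (fun _ => 0) fun _ => 1) (Sum.elim (fun _ => -2) fun _ => 0)

theorem constraints_strictly_feasible :
    {x | ∀ s, constraintForm C s x < constraintBound C s}.Nonempty := by
  -- Here `g n = -2 n (n - 1)`, with concavity gain `4 (a - b - 1) ≥ 4 > 2`. The price `4 K + 5`
  -- outweighs the steepest drop `4 (K - 1)` of `g` together with a penalty `1 / 2`.
  let x : ValuationParam C := (fun _ => 4 * K + 5,
    fun i => -2 * ((i : ℝ) + 2) * ((i : ℝ) + 1), fun _ => 1 / 2)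
  have hl : ∀ n ≤ K, levelValue C n x = -2 * (n : ℝ) * ((n : ℝ) - 1) := by
    intro n hn
    by_cases h : 2 ≤ n
    · rw [levelValue, dif_pos ⟨h, hn⟩]
      simp only [x, LinearMap.comp_apply, LinearMap.proj_apply, LinearMap.fst_apply,
        LinearMap.snd_apply]
      rw [Nat.cast_sub h]
      push_cast
      ring
    · rw [levelValue_of_lt C (by omega)]
      rcases (show n = 0 ∨ n = 1 by omega) with rfl | rfl <;> simp
  have hw : ∀ A ∈ C, codePenalty C A x = 1 / 2 := fun A hA => by
    rw [codePenalty, dif_pos hA]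
    simp [x]
  have hw' : ∀ A, 0 ≤ codePenalty C A x ∧ codePenalty C A x ≤ 1 / 2 := fun A => by
    by_cases hA : A ∈ C
    · norm_num [hw A hA]
    · norm_num [codePenalty_of_notMem C hA]
  refine ⟨x, ?_⟩
  rintro ((A | A) | ⟨⟨a, b⟩, hab⟩ | ⟨⟨A, B⟩, hAB⟩)
  · simp only [constraintForm, constraintBound, Sum.elim_inl, LinearMap.neg_apply, hw A A.2]
    norm_num
  · simp only [constraintForm, constraintBound, Sum.elim_inl, Sum.elim_inr, hw A A.2]
    norm_num
  · have ha := a.2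
    dsimp only at hab
    simp only [constraintForm, constraintBound, Sum.elim_inl, Sum.elim_inr, LinearMap.sub_apply,
      LinearMap.add_apply]
    rw [hl a (by omega), hl b (by omega), hl (a - 1) (by omega), hl (b + 1) (by omega),
      Nat.cast_sub (by omega)]
    have : (b : ℝ) + 2 ≤ (a : ℝ) := by exact_mod_cast hab
    push_cast
    linarith
  · dsimp only at hAB
    simp only [constraintForm, constraintBound, Sum.elim_inr, LinearMap.sub_apply,
      LinearMap.comp_apply, LinearMap.proj_apply, paramValuation_apply]
    have hBK : B.card ≤ K := by simpa using Finset.card_le_univ B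
    have hlt := Finset.card_lt_card hAB
    rw [hl _ hBK, hl _ (by omega)]
    have hA := (hw' A).1
    have hB := (hw' B).2
    have h1 : (A.card : ℝ) + 1 ≤ B.card := by exact_mod_cast hlt
    have h2 : (B.card : ℝ) ≤ K := by exact_mod_cast hBK
    simp only [x, Finset.sum_const, nsmul_eq_mul]
    nlinarith [mul_nonneg (sub_nonneg.2 h1)
      (show (0 : ℝ) ≤ 4 * K + 7 - 2 * (A.card + B.card) by linarith)]

theorem paramValuation_mem_substituteValuations {C : Finset (Finset (Fin K))}
    (hC : IsAsymmetricCode C) (hcard : ∀ A ∈ C, 2 ≤ A.card ∧ A.card < K) {x : ValuationParam C}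
    (hx : ∀ s, constraintForm C s x ≤ constraintBound C s) :
    paramValuation C x ∈ substituteValuations K := by
  have hw : ∀ A, 0 ≤ codePenalty C A x ∧ codePenalty C A x ≤ 1 := fun A => by
    by_cases hA : A ∈ C
    · have h0 := hx (Sum.inl (Sum.inl ⟨A, hA⟩))
      have h1 := hx (Sum.inl (Sum.inr ⟨A, hA⟩))
      simp only [constraintForm, constraintBound, Sum.elim_inl, Sum.elim_inr,
        LinearMap.neg_apply] at h0 h1
      exact ⟨by linarith, h1⟩
    · simp [codePenalty_of_notMem C hA]
  refine ⟨?_, fun A B hAB => ?_, HasExchangeProperty.hasSubstituteProperty ?_⟩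
  · rw [paramValuation_apply, levelValue_of_lt C (by simp),
      codePenalty_of_notMem C (fun h => by simpa using (hcard _ h).1)]
    simp
  · rcases hAB.eq_or_ssubset with rfl | h
    · rfl
    · have := hx (Sum.inr (Sum.inr ⟨(A, B), h⟩))
      simp only [constraintForm, constraintBound, Sum.elim_inr, LinearMap.sub_apply,
        LinearMap.comp_apply, LinearMap.proj_apply] at this
      linarith
  · have hg : ∀ a b, b + 2 ≤ a → a ≤ K → levelValue C a x + levelValue C b x + 2 ≤
        levelValue C (a - 1) x + levelValue C (b + 1) x := by
      intro a b hab haK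
      have := hx (Sum.inr (Sum.inl ⟨(⟨a, by omega⟩, ⟨b, by omega⟩), hab⟩))
      simp only [constraintForm, constraintBound, Sum.elim_inr, Sum.elim_inl, LinearMap.sub_apply,
        LinearMap.add_apply] at this
      linarith
    have h := (hC.hasExchangeProperty hg (w := fun A => codePenalty C A x) (fun A => (hw A).1)
      (fun A => (hw A).2) fun A hA => by simp [codePenalty_of_notMem C hA]).modular_add x.1
    rwa [← funext (paramValuation_apply C x)] at h

end Construction

/-! ### Dimension count and code sizes -/

theorem exists_polyhedron_of_isAsymmetricCode {K : ℕ} (hK : 2 ≤ K) {C : Finset (Finset (Fin K))}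
    (hC : IsAsymmetricCode C) (hcard : ∀ A ∈ C, 2 ≤ A.card ∧ A.card < K) :
    ∃ P : Set (BundleFun K), IsPolyhedron P ∧ P ⊆ substituteValuations K ∧
      polyhedronDim P = 2 * K - 1 + C.card := by
  have hinj := paramValuation_injective hC hcard
  have hne := constraints_strictly_feasible C
  refine ⟨paramValuation C '' {x | ∀ s, constraintForm C s x ≤ constraintBound C s},
    isPolyhedron_image _ hinj _ _ (hne.mono fun x hx s => (hx s).le), ?_, ?_⟩
  · rintro _ ⟨x, hx, rfl⟩
    exact paramValuation_mem_substituteValuations hC hcard hx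
  · rw [← finrank_valuationParam C hK]
    exact polyhedronDim_image _ hinj _ _ hne

theorem exists_polyhedron_of_lt_two_pow {K n : ℕ} (hK : 2 ≤ K)
    (hn : (K + 1) * n + 1 < 2 ^ K) :
    ∃ P : Set (BundleFun K), IsPolyhedron P ∧ P ⊆ substituteValuations K ∧
      polyhedronDim P = 2 * K - 1 + n := by
  obtain ⟨C, hC, hcard, rfl⟩ := exists_isAsymmetricCode hn
  exact exists_polyhedron_of_isAsymmetricCode hK hC hcard

theorem sq_le_mul_two_pow_add_two {K : ℕ} (hK : 2 ≤ K) :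
    K ^ 2 ≤ (K - 1) * 2 ^ (K - 1) + 2 := by
  induction K, hK using Nat.le_induction with
  | base => norm_num
  | succ m hm ih =>
    obtain ⟨k, rfl⟩ := Nat.exists_eq_add_of_le' hm
    simp only [show k + 2 - 1 = k + 1 from rfl, show k + 2 + 1 - 1 = k + 2 from rfl] at ih ⊢
    have : k + 2 ≤ 2 ^ (k + 1) := Nat.lt_two_pow_self
    rw [pow_succ 2 (k + 1)]
    nlinarith

/-- The number `⌈(2 ^ (K - 1) - 2) / K⌉` is an admissible size of an asymmetric code. -/
theorem exists_code_size {K : ℕ} (hK : 2 ≤ K) :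
    ∃ n : ℕ, ((2 : ℝ) ^ (K - 1) - 2) / K ≤ n ∧ (K + 1) * n + 1 < 2 ^ K := by
  have hsq := sq_le_mul_two_pow_add_two hK
  obtain ⟨k, rfl⟩ := Nat.exists_eq_add_of_le' hK
  simp only [show k + 2 - 1 = k + 1 from rfl] at hsq ⊢
  have htwo : 2 ≤ 2 ^ (k + 1) := Nat.le_self_pow (by omega) 2
  set N := 2 ^ (k + 1) with hN
  have hmod := Nat.div_add_mod (N - 2 + (k + 1)) (k + 2)
  have hmod' := Nat.mod_lt (N - 2 + (k + 1)) (show k + 2 > 0 by omega)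
  -- With `K = k + 2`, adding `K - 1` before dividing rounds `(N - 2) / K` up.
  refine ⟨(N - 2 + (k + 1)) / (k + 2), ?_, ?_⟩
  · rw [div_le_iff₀ (by positivity)]
    have h : N ≤ (N - 2 + (k + 1)) / (k + 2) * (k + 2) + 2 := by
      rw [mul_comm]
      omega
    have h' : (N : ℝ) ≤ (((N - 2 + (k + 1)) / (k + 2) : ℕ) : ℝ) * ((k + 2 : ℕ) : ℝ) + 2 := by
      exact_mod_cast h
    have hN' : (N : ℝ) = 2 ^ (k + 1) := by simp [hN]
    linarith
  · rw [show 2 ^ (k + 2) = 2 * N by rw [hN, ← pow_succ']]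
    have h : (k + 2) * ((N - 2 + (k + 1)) / (k + 2)) + 1 ≤ N + k := by omega
    generalize (N - 2 + (k + 1)) / (k + 2) = n at h ⊢
    by_contra! hcon
    nlinarith

theorem mainTheorem1 :
    (∃ P : Set (BundleFun 16),
      IsPolyhedron P ∧ P ⊆ substituteValuations 16 ∧ polyhedronDim P = 2727) ∧
    (∃ P : Set (BundleFun 24),
      IsPolyhedron P ∧ P ⊆ substituteValuations 24 ∧ polyhedronDim P = 424607) ∧
    (∀ K : ℕ, 2 ≤ K → ∃ P : Set (BundleFun K),
      IsPolyhedron P ∧ P ⊆ substituteValuations K ∧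
        2 * (K : ℝ) - 1 + ((2 : ℝ) ^ (K - 1) - 2) / (K : ℝ) ≤ (polyhedronDim P : ℝ)) := by
  -- `2727 = 31 + 2696` and `424607 = 47 + 424560`, where `31` and `47` are `2 K - 1`.
  refine ⟨exists_polyhedron_of_lt_two_pow (n := 2696) (by norm_num) (by norm_num),
    exists_polyhedron_of_lt_two_pow (n := 424560) (by norm_num) (by norm_num), fun K hK => ?_⟩
  obtain ⟨n, hn, hnK⟩ := exists_code_size hK
  obtain ⟨P, hP, hsub, hdim⟩ := exists_polyhedron_of_lt_two_pow hK hnK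
  refine ⟨P, hP, hsub, ?_⟩
  rw [hdim, Nat.cast_add, Nat.cast_sub (by omega)]
  push_cast
  linarith
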